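/- **Traces.** An event is a pair $\langle t,\mathsf{op}\rangle$ of a thread $t$ and an operation $\mathsf{op}\in\{\mathtt r(x),\mathtt w(x),\mathtt{acq}(\ell),\mathtt{rel}(\ell)\}$ (read/write of a variable $x$, acquire/release of a lock $\ell$). A trace $\sigma$ is a finite sequence of events such that for every lock $\ell$ the subsequence of events on $\ell$ is a prefix of a word in $\big(\sum_t \langle t,\mathtt{acq}(\ell)\rangle\langle t,\mathtt{rel}(\ell)\rangle\big)^*$. A correct reordering of $\sigma$ is a trace $\rho$ consisting of distinct events (positions) of $\sigma$, whose event set is downward closed in the thread order of $\sigma$, whose thread order is contained in that of $\sigma$, and in which every read has the same last preceding write to its variable (or none) as in $\sigma$. It is sync-preserving if any two acquires of the same lock that occur in $\rho$ are ordered in $\rho$ as in $\sigma$. An event $e$ of $\sigma$ is enabled in $\rho$ if $e\notin\rho$ but all events before $e$ in its thread are in $\rho$. A sync-preserving race of $\sigma$ is a pair of events of different threads that access a common variable, at least one of them writing, and that are both enabled in some sync-preserving correct reordering of $\sigma$. Sync-preserving race prediction asks whether a given trace has a sync-preserving race. **Instances.** Let $\tau,L:\mathbb N\to\mathbb N$ satisfy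 $\tau(\mathcal N)\ge 2$ for all large $\mathcal N$ and $L(\mathcal N)=\Omega(\log\mathcal N)$, and suppose that, for some $\varepsilon>0$, $\tau(\mathcal N)\le(1-\varepsilon)\mathcal N$ and $L(\mathcal N)\le(1-\varepsilon)\mathcal N$ for all large $\mathcal N$. The instances of size $\mathcal N$ are the traces with exactly $\mathcal N$ events, $\tau(\mathcal N)$ threads (named $0,\dots,\tau(\mathcal N)-1$), $L(\mathcal N)$ locks (named $0,\dots,L(\mathcal N)-1$), and variables named by numbers below $\mathcal N$. A trace is given to the machine as the concatenation of the code words of its events, where each event has a non-empty code word over a fixed finite alphabet; the code may be any such assignment, and the code word of an event may depend on $\mathcal N$. **Machines.** A Turing machine is deterministic, with a two-way read-only input tape delimited by end markers and a fixed number, at least one, of two-way infinite read-write work tapes. Time is the number of steps, space the number of work-tape cells visited. **Theorem.** Let $M$ be a Turing machine that solves sync-preserving race prediction on all these instances, and let $T,S:\mathbb N\to\mathbb N$ be such that on every instance of size $\mathcal N$ it runs in time at most $T(\mathcal N)$ and space at most $S(\mathcal N)$. Then $$T(\mathcal N)\cdot S(\mathcal N)=\Omega\!\left(\frac{\mathcal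 N^2}{\log^2\mathcal N}\right).$$ -/

import Mathlib

open Filter Asymptotics

namespace SyncRace

/-! ### Traces -/

/-- Operations on shared variables and on locks; variables and locks are named by numbers. -/
inductive Op where
  | read (x : ℕ)
  | write (x : ℕ)
  | acq (l : ℕ)
  | rel (l : ℕ)
  deriving DecidableEq

/-- An event: the performing thread and the operation. The unique identifier of an event of a
trace is its position in the trace. -/
structure Event where
  thread : ℕ
  op : Op
  deriving DecidableEq

/-- The operation acquires or releases the lock `l`. -/
def Op.OnLock (l : ℕ) (o : Op) : Prop := o = .acq l ∨ o = .rel l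

instance (l : ℕ) (o : Op) : Decidable (o.OnLock l) := by
  unfold Op.OnLock; infer_instance

/-- The lock named by the operation, if any. -/
def Op.lock? : Op → Option ℕ
  | .acq l => some l
  | .rel l => some l
  | _ => none

/-- The variable named by the operation, if any. -/
def Op.var? : Op → Option ℕ
  | .read x => some x
  | .write x => some x
  | _ => none

/-- The threads of a sequence of events. -/
def threads (σ : List Event) : Finset ℕ := (σ.map Event.thread).toFinset

/-- The locks of a sequence of events. -/
def locks (σ : List Event) : Finset ℕ := (σ.filterMap fun e => e.op.lock?).toFinset

/-- The variables of a sequence of events. -/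
def vars (σ : List Event) : Finset ℕ := (σ.filterMap fun e => e.op.var?).toFinset

/-- A sequence of events is a trace if it obeys lock semantics: for every lock `l`, its projection
to the events on `l` is a prefix of a word of `(∑ t, ⟨t, acq l⟩ ⟨t, rel l⟩)^*`. -/
def IsTrace (σ : List Event) : Prop :=
  ∀ l : ℕ, ∃ ts : List ℕ,
    (σ.filter fun e => e.op.OnLock l) <+: ts.flatMap fun t => [⟨t, .acq l⟩, ⟨t, .rel l⟩]

/-! ### Orders, reorderings and races

Let `σ` be a trace. A sequence of pairwise distinct events of `σ` is a duplicate-free list `ρ` of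
positions of `σ`; the trace `σ` itself is `List.finRange σ.length`. -/

section Orders

variable (σ : List Event)

/-- The thread of an event of `σ`. -/
def threadOf (e : Fin σ.length) : ℕ := (σ.get e).thread

/-- The operation of an event of `σ`. -/
def opOf (e : Fin σ.length) : Op := (σ.get e).op

/-- The trace order of `ρ` on the events of `ρ`. -/
def TraceOrder (ρ : List (Fin σ.length)) (e₁ e₂ : Fin σ.length) : Prop :=
  e₁ ∈ ρ ∧ e₂ ∈ ρ ∧ ρ.idxOf e₁ ≤ ρ.idxOf e₂

/-- The thread order of `ρ` on the events of `ρ`. -/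
def ThreadOrder (ρ : List (Fin σ.length)) (e₁ e₂ : Fin σ.length) : Prop :=
  TraceOrder σ ρ e₁ e₂ ∧ threadOf σ e₁ = threadOf σ e₂

/-- The last write to `x` that occurs before `e` in `ρ`, if there is one. -/
def lastWrite (ρ : List (Fin σ.length)) (x : ℕ) (e : Fin σ.length) : Option (Fin σ.length) :=
  (ρ.filter fun e' => opOf σ e' = .write x ∧ ρ.idxOf e' < ρ.idxOf e).getLast?

/-- `ρ` is a correct reordering of `σ`. -/
structure CorrectReordering (ρ : List (Fin σ.length)) : Prop where
  nodup : ρ.Nodup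
  isTrace : IsTrace (ρ.map σ.get)
  downward_closed : ∀ e e', ThreadOrder σ (List.finRange σ.length) e e' → e' ∈ ρ → e ∈ ρ
  threadOrder_le : ∀ e e', ThreadOrder σ ρ e e' → ThreadOrder σ (List.finRange σ.length) e e'
  lastWrite_eq : ∀ e ∈ ρ, ∀ x, opOf σ e = .read x →
    lastWrite σ ρ x e = lastWrite σ (List.finRange σ.length) x e

/-- `ρ` does not change the order of any two acquires of the same lock. -/
def SyncPreserving (ρ : List (Fin σ.length)) : Prop :=
  ∀ l : ℕ, ∀ e₁ ∈ ρ, ∀ e₂ ∈ ρ, opOf σ e₁ = .acq l → opOf σ e₂ = .acq l →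
    (TraceOrder σ ρ e₁ e₂ ↔ TraceOrder σ (List.finRange σ.length) e₁ e₂)

/-- Two events of different threads access a common variable and at least one of them writes. -/
def Conflicting (e₁ e₂ : Fin σ.length) : Prop :=
  threadOf σ e₁ ≠ threadOf σ e₂ ∧ ∃ x : ℕ,
    (opOf σ e₁ = .read x ∨ opOf σ e₁ = .write x) ∧
    (opOf σ e₂ = .read x ∨ opOf σ e₂ = .write x) ∧
    (opOf σ e₁ = .write x ∨ opOf σ e₂ = .write x)

/-- `e` is `σ`-enabled in `ρ`. -/
def Enabled (ρ : List (Fin σ.length)) (e : Fin σ.length) : Prop :=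
  e ∉ ρ ∧ ∀ e', e' ≠ e → ThreadOrder σ (List.finRange σ.length) e' e → e' ∈ ρ

/-- `(e₁, e₂)` is a sync-preserving race of `σ`. -/
def IsSyncPreservingRace (e₁ e₂ : Fin σ.length) : Prop :=
  Conflicting σ e₁ e₂ ∧ ∃ ρ : List (Fin σ.length),
    CorrectReordering σ ρ ∧ SyncPreserving σ ρ ∧ Enabled σ ρ e₁ ∧ Enabled σ ρ e₂

/-- `σ` has a sync-preserving race. -/
def HasSyncPreservingRace : Prop := ∃ e₁ e₂, IsSyncPreservingRace σ e₁ e₂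

end Orders

/-- The traces with `N` events, exactly `τ` threads and exactly `L` locks. Threads and locks are
named `0, 1, …`, and variable names are below `N`, so that there are finitely many such traces. -/
def traceClass (N τ L : ℕ) : Set (List Event) :=
  {σ | IsTrace σ ∧ σ.length = N ∧ threads σ = Finset.range τ ∧ locks σ = Finset.range L ∧
    vars σ ⊆ Finset.range N}

/-! ### Turing machines -/

/-- Head moves. -/
inductive Move where
  | left
  | stay
  | right

/-- The content of a cell of the input tape: an input letter or one of the two end markers. -/
inductive InCell (A : Type) where
  | leftEnd
  | letter (a : A)
  | rightEnd

/-- What a machine with state set `Q`, work alphabet `Γ` and `k + 1` work tapes does in one step. -/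
structure Action (Q Γ : Type) (k : ℕ) where
  next : Q
  inMove : Move
  write : Fin (k + 1) → Γ
  workMove : Fin (k + 1) → Move

/-- A deterministic Turing machine with a two-way read-only input tape over the alphabet `A` and
`k + 1` two-way infinite read-write work tapes. A state with verdict `some b` is halting, with
answer `b`. -/
structure Machine (A : Type) where
  k : ℕ
  Q : Type
  Γ : Type
  finQ : Finite Q
  finΓ : Finite Γ
  blank : Γ
  start : Q
  verdict : Q → Option Bool
  δ : Q → InCell A → (Fin (k + 1) → Γ) → Action Q Γ k

namespace Machine

variable {A : Type} (M : Machine A)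

/-- Configurations. The input head is at `inPos`, the head of work tape `i` at `pos i`. -/
structure Cfg where
  state : M.Q
  inPos : ℕ
  work : Fin (M.k + 1) → ℤ → M.Γ
  pos : Fin (M.k + 1) → ℤ

/-- The input tape for `w`: cell `0` holds the left end marker, cells `1, …, |w|` hold `w`, and
cell `|w| + 1` holds the right end marker. -/
def inCell (w : List A) : ℕ → InCell A
  | 0 => .leftEnd
  | p + 1 => match w[p]? with
    | some a => .letter a
    | none => .rightEnd

/-- The input head moves one cell, but never beyond the end markers. -/
def moveIn (w : List A) (p : ℕ) : Move → ℕ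
  | .left => p - 1
  | .stay => p
  | .right => min (p + 1) (w.length + 1)

/-- A work head moves one cell. -/
def moveWork (p : ℤ) : Move → ℤ
  | .left => p - 1
  | .stay => p
  | .right => p + 1

/-- One step on input `w`; halting configurations do not change. -/
def step (w : List A) (c : M.Cfg) : M.Cfg :=
  match M.verdict c.state with
  | some _ => c
  | none =>
    let a := M.δ c.state (inCell w c.inPos) fun i => c.work i (c.pos i)
    { state := a.next
      inPos := moveIn w c.inPos a.inMove
      work := fun i => Function.update (c.work i) (c.pos i) (a.write i)
      pos := fun i => moveWork (c.pos i) (a.workMove i) }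

/-- The initial configuration: blank work tapes, input head on the left end marker. -/
def initial : M.Cfg where
  state := M.start
  inPos := 0
  work := fun _ _ => M.blank
  pos := fun _ => 0

/-- The configuration after `t` steps on input `w`. -/
def run (w : List A) (t : ℕ) : M.Cfg := (M.step w)^[t] M.initial

/-- On input `w`, the machine halts with answer `b` after at most `t` steps. -/
def AnswersWithin (w : List A) (b : Bool) (t : ℕ) : Prop :=
  ∃ t' ≤ t, M.verdict (M.run w t').state = some b

/-- On input `w`, the machine halts with answer `b`. -/
def Answers (w : List A) (b : Bool) : Prop := ∃ t, M.AnswersWithin w b t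

/-- On input `w`, the machine halts after at most `t` steps. -/
def TimeAtMost (w : List A) (t : ℕ) : Prop := ∃ b, M.AnswersWithin w b t

/-- The number of work tape cells that are visited on input `w`, summed over the work tapes. -/
noncomputable def spaceUsed (w : List A) : ℕ∞ :=
  ∑ i, (Set.range fun t => (M.run w t).pos i).encard

end Machine

/-- The input word for a trace `σ` if `code N e` is the code word of the event `e` in traces with
`N` events: the concatenation of the code words of its events. -/
def encode {A : Type} (code : ℕ → Event → List A) (σ : List Event) : List A :=
  σ.flatMap (code σ.length)

/-- `M` solves sync-preserving race prediction on the traces with `N` events, `τ N` threads and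
`L N` locks, for every `N`. -/
def Solves {A : Type} (code : ℕ → Event → List A) (τ L : ℕ → ℕ) (M : Machine A) : Prop :=
  ∀ N, ∀ σ ∈ traceClass N (τ N) (L N), ∃ b : Bool,
    M.Answers (encode code σ) b ∧ (b = true ↔ HasSyncPreservingRace σ)

/-- On these traces, `M` runs in time `T N`. -/
def RunsInTime {A : Type} (code : ℕ → Event → List A) (τ L : ℕ → ℕ) (M : Machine A)
    (T : ℕ → ℕ) : Prop :=
  ∀ N, ∀ σ ∈ traceClass N (τ N) (L N), M.TimeAtMost (encode code σ) (T N)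

/-- On these traces, `M` runs in space `S N`. -/
def RunsInSpace {A : Type} (code : ℕ → Event → List A) (τ L : ℕ → ℕ) (M : Machine A)
    (S : ℕ → ℕ) : Prop :=
  ∀ N, ∀ σ ∈ traceClass N (τ N) (L N), M.spaceUsed (encode code σ) ≤ S N

end SyncRace

/-!
Race prediction is as hard as set disjointness, and disjointness is hard for machines that have to
carry information over a long gap of the input tape.

For sets `X, Y` of `n` elements, let thread `0` write the variable `i + 1` for each `i ∈ X` and let
thread `1` write `i + 1` for each `i ∈ Y`; in between there are `G` events, acquires of distinct
locks and reads of a variable that is never written, which provide the required threads and locks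
(`disjTrace`). No lock is ever released and no variable is both read and written, so the
predecessors of two events in their threads always form a sync-preserving correct reordering
(`isSyncPreservingRace_of_conflicting`). Hence there is a race if and only if `X` and `Y` meet
(`hasSyncPreservingRace_disjTrace`).

The crossing sequence of a run consists of the configurations in which the input head has just
traversed the gap. If the inputs for `(X, Xᶜ)` and `(X', X'ᶜ)` had the same crossing sequence, then
the machine would give the same answer, no race, for `(X, X'ᶜ)` and `(X', Xᶜ)`
(`Machine.exists_verdict_of_crossings_eq`), so that `X = X'`. Therefore the `2 ^ n` sets `X` have
different crossing sequences. These have length at most `T / G`, as the code words of the events in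
the gap are non-empty (`Machine.length_crossings_mul_le`), and in space `S` there are only
`2 ^ O(S)` configurations (`Machine.card_bounded_add_one_le`). So `n = O(S * T / G)`
(`mul_le_time_mul_space`). As threads and locks need at most `(1 - ε) * N` events, both `n` and `G`
can be chosen linear in `N`, and `T * S` is even of order at least `N ^ 2`.
-/

namespace SyncRace

/-! ### Crossing a gap of the input tape -/

namespace Machine

variable {A : Type} (M : Machine A)

variable {M} in
/-- The configuration without its input head position (which is set to `0`). -/
def Cfg.forget (c : M.Cfg) : M.Cfg := { c with inPos := 0 }

/-- Leaving a side of a gap of `g` cells that follows the cells `0, …, lo` of the input tape. The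
left side (`false`) is everything up to the end of the gap, the right side (`true`) is everything
from the start of the gap on, so the two sides overlap in the gap. -/
def Exits (lo g : ℕ) (side : Bool) (p : ℕ) : Prop :=
  if side then p ≤ lo else lo + g < p

instance (lo g : ℕ) (side : Bool) (p : ℕ) : Decidable (Exits lo g side p) := by
  unfold Exits; infer_instance

/-- The crossing sequence of `t` steps from `c`: the configurations, without their input head
position, in which the head has just left the side of the gap that it was on. -/
def crossings (w : List A) (lo g : ℕ) : Bool → ℕ → M.Cfg → List M.Cfg
  | _, 0, _ => []
  | side, t + 1, c =>
    if Exits lo g side (M.step w c).inPos then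
      (M.step w c).forget :: crossings w lo g (!side) t (M.step w c)
    else crossings w lo g side t (M.step w c)

/-- Two configurations that differ only in the input head position, which has the same offset
from `lo` in the first and from `lo'` in the second. -/
def Shifted (lo lo' : ℕ) (c c' : M.Cfg) : Prop :=
  c.forget = c'.forget ∧ c.inPos + lo' = c'.inPos + lo

theorem step_of_verdict {w : List A} {c : M.Cfg} {b : Bool} (h : M.verdict c.state = some b) :
    M.step w c = c := by
  simp [step, h]

theorem inPos_step_le (w : List A) (c : M.Cfg) : (M.step w c).inPos ≤ c.inPos + 1 := by
  unfold step
  split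
  · omega
  · simp only
    cases (M.δ c.state (inCell w c.inPos) fun i => c.work i (c.pos i)).inMove <;>
      simp only [moveIn] <;> omega

theorem inPos_le_step (w : List A) (c : M.Cfg) (h : c.inPos ≤ w.length + 1) :
    c.inPos ≤ (M.step w c).inPos + 1 := by
  unfold step
  split
  · omega
  · simp only
    cases (M.δ c.state (inCell w c.inPos) fun i => c.work i (c.pos i)).inMove <;>
      simp only [moveIn] <;> omega

theorem inPos_step_le_length (w : List A) (c : M.Cfg) (h : c.inPos ≤ w.length + 1) :
    (M.step w c).inPos ≤ w.length + 1 := by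
  unfold step
  split
  · omega
  · simp only
    cases (M.δ c.state (inCell w c.inPos) fun i => c.work i (c.pos i)).inMove <;>
      simp only [moveIn] <;> omega

/-- Steps preserve `Shifted` if both heads read the same cell and their moves agree. -/
theorem Shifted.step {w w' : List A} {lo lo' : ℕ} {c c' : M.Cfg} (h : M.Shifted lo lo' c c')
    (hcell : inCell w c.inPos = inCell w' c'.inPos)
    (hmove : ∀ m, moveIn w c.inPos m + lo' = moveIn w' c'.inPos m + lo) :
    M.Shifted lo lo' (M.step w c) (M.step w' c') := by
  obtain ⟨q, p, wk, ps⟩ := c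
  obtain ⟨q', p', wk', ps'⟩ := c'
  obtain ⟨h1, h2⟩ := h
  simp only [Cfg.forget, Cfg.mk.injEq, true_and] at h1
  obtain ⟨rfl, rfl, rfl⟩ := h1
  simp only at hcell hmove h2
  unfold Machine.step
  simp only [hcell]
  cases hv : M.verdict q with
  | some b => exact ⟨rfl, h2⟩
  | none => exact ⟨rfl, hmove _⟩

/-- On the left side of the gap, a step does not depend on what follows the gap. -/
theorem Shifted.step_left (a g b b' : List A) {c c' : M.Cfg}
    (hc : ¬ Exits a.length g.length false c.inPos) (h : M.Shifted a.length a.length c c') :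
    M.Shifted a.length a.length (M.step (a ++ (g ++ b)) c) (M.step (a ++ (g ++ b')) c') := by
  have hp : c'.inPos = c.inPos := by have := h.2; omega
  simp only [Exits, Bool.false_eq_true, if_false, not_lt] at hc
  refine h.step M ?_ ?_
  · rw [hp]
    cases hq : c.inPos with
    | zero => rfl
    | succ q =>
      have : q < (a ++ g).length := by simp; omega
      simp only [inCell, ← List.append_assoc]
      rw [List.getElem?_append_left this, List.getElem?_append_left this]
  · rw [hp]
    intro m
    cases m <;> simp only [moveIn, List.length_append] <;> omega

/-- On the right side of the gap, a step does not depend on what precedes the gap. -/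
theorem Shifted.step_right (a a' g b : List A) {c c' : M.Cfg}
    (hc : ¬ Exits a.length g.length true c.inPos) (h : M.Shifted a.length a'.length c c') :
    M.Shifted a.length a'.length (M.step (a ++ (g ++ b)) c) (M.step (a' ++ (g ++ b)) c') := by
  have hp := h.2
  simp only [Exits, if_true, not_le] at hc
  obtain ⟨q, hq⟩ : ∃ q, c.inPos = a.length + q + 1 := ⟨c.inPos - a.length - 1, by omega⟩
  have hq' : c'.inPos = a'.length + q + 1 := by omega
  refine h.step M ?_ ?_
  · rw [hq, hq']
    simp only [inCell]
    have key : ∀ u v : List A, (u ++ v)[u.length + q]? = v[q]? := by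
      intro u v
      rw [List.getElem?_append_right (by omega), Nat.add_sub_cancel_left]
    rw [key, key]
  · rw [hq, hq']
    intro m
    cases m <;> simp only [moveIn, List.length_append] <;> omega

/-- Crossing the gap takes at least `g` steps. The last summand is the way across the gap that the
head has already covered. -/
theorem length_crossings_mul_le (w : List A) (lo g t : ℕ) :
    ∀ (side : Bool) (c : M.Cfg), c.inPos ≤ w.length + 1 → ¬ Exits lo g side c.inPos →
      (M.crossings w lo g side t c).length * g ≤
        t + if side then lo + g + 1 - c.inPos else c.inPos - lo := by
  induction t with
  | zero => intro side c _ _; simp [crossings]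
  | succ t ih =>
    intro side c hl hc
    have h1 := M.inPos_step_le w c
    have h2 := M.inPos_le_step w c hl
    have h3 := M.inPos_step_le_length w c hl
    have ih₀ := ih false _ h3
    have ih₁ := ih true _ h3
    cases side <;> simp only [Exits, if_true, if_false, Bool.false_eq_true] at hc ih₀ ih₁ ⊢ <;>
      simp only [crossings, Exits, if_true, if_false, Bool.false_eq_true, Bool.not_false,
        Bool.not_true] <;> split_ifs with he <;>
      try simp only [List.length_cons, add_mul, one_mul]
    all_goals omega

theorem exists_of_mem_crossings (w : List A) (lo g t : ℕ) :
    ∀ (side : Bool) (c x : M.Cfg), x ∈ M.crossings w lo g side t c →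
      ∃ s, x = ((M.step w)^[s] c).forget := by
  induction t with
  | zero => intro side c x h; simp [crossings] at h
  | succ t ih =>
    intro side c x h
    rw [crossings] at h
    split_ifs at h
    · rcases List.mem_cons.1 h with h | h
      · exact ⟨1, h⟩
      · obtain ⟨s, hs⟩ := ih _ _ _ h
        exact ⟨s + 1, hs⟩
    · obtain ⟨s, hs⟩ := ih _ _ _ h
      exact ⟨s + 1, hs⟩

/-- Without a crossing, the runs on two inputs that agree on the side of the head stay parallel. -/
theorem Shifted.iterate {w w' : List A} {lo lo' g : ℕ} {side : Bool}
    (hsim : ∀ c c', ¬ Exits lo g side c.inPos → M.Shifted lo lo' c c' →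
      M.Shifted lo lo' (M.step w c) (M.step w' c')) (t : ℕ) :
    ∀ c c', ¬ Exits lo g side c.inPos → M.Shifted lo lo' c c' →
      M.crossings w lo g side t c = [] →
      M.Shifted lo lo' ((M.step w)^[t] c) ((M.step w')^[t] c') := by
  induction t with
  | zero => intro c c' _ h _; exact h
  | succ t ih =>
    intro c c' hc h hn
    rw [crossings] at hn
    split_ifs at hn with he
    exact ih _ _ he (hsim _ _ hc h) hn

/-- The runs on two inputs that agree on the side of the head stay parallel up to and including
the next crossing. -/
theorem Shifted.exists_crossing {w w' : List A} {lo lo' g : ℕ} {side : Bool}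
    (hsim : ∀ c c', ¬ Exits lo g side c.inPos → M.Shifted lo lo' c c' →
      M.Shifted lo lo' (M.step w c) (M.step w' c')) {x : M.Cfg} {l : List M.Cfg} (t : ℕ) :
    ∀ c c', c.inPos ≤ w.length + 1 → ¬ Exits lo g side c.inPos → M.Shifted lo lo' c c' →
      M.crossings w lo g side t c = x :: l →
      ∃ s t', t = s + t' ∧ M.Shifted lo lo' ((M.step w)^[s] c) ((M.step w')^[s] c') ∧
        ((M.step w)^[s] c).forget = x ∧
        ((M.step w)^[s] c).inPos = lo + (if side then 0 else g + 1) ∧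
        M.crossings w lo g (!side) t' ((M.step w)^[s] c) = l := by
  induction t with
  | zero => intro c c' _ _ _ h; simp [crossings] at h
  | succ t ih =>
    intro c c' hl hc h hn
    have h1 := M.inPos_step_le w c
    have h2 := M.inPos_le_step w c hl
    have h3 := M.inPos_step_le_length w c hl
    rw [crossings] at hn
    split_ifs at hn with he
    · obtain ⟨rfl, rfl⟩ := List.cons.inj hn
      refine ⟨1, t, by omega, hsim _ _ hc h, rfl, ?_, rfl⟩
      change (M.step w c).inPos = _
      cases side <;> simp_all [Exits] <;> omega
    · obtain ⟨s, t', rfl, h4, h5, h6, h7⟩ := ih _ _ h3 he (hsim _ _ hc h) hn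
      exact ⟨s + 1, t', by omega, h4, h5, h6, h7⟩

/-- Cut and paste: let `m` be a configuration on an input `w` that agrees with `W false` up to the
end of the gap and with `W true` from the start of the gap on. If the runs from `c false` and
`c true` on `W false` and `W true` have the same crossing sequence and give the same answer,
then so does the run from `m`, because on each side it imitates the run on the word that it agrees
with there. -/
theorem exists_verdict_of_crossings_eq (W : Bool → List A) (w : List A) (lo : Bool → ℕ)
    (lo' g : ℕ) (hw : ∀ s, lo s + g ≤ (W s).length)
    (hsim : ∀ s c c', ¬ Exits (lo s) g s c.inPos → M.Shifted (lo s) lo' c c' →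
      M.Shifted (lo s) lo' (M.step (W s) c) (M.step w c')) (ans : Bool) (l : List M.Cfg) :
    ∀ (side : Bool) (c : Bool → M.Cfg) (t : Bool → ℕ) (m : M.Cfg),
      (∀ s, (c s).inPos ≤ (W s).length + 1) →
      (∀ s, ¬ Exits (lo s) g side (c s).inPos) →
      (∀ s, M.crossings (W s) (lo s) g side (t s) (c s) = l) →
      (∀ s, M.verdict ((M.step (W s))^[t s] (c s)).state = some ans) →
      M.Shifted (lo side) lo' (c side) m →
      ∃ r, M.verdict ((M.step w)^[r] m).state = some ans := by
  induction l with
  | nil =>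
    intro side c t m hl hc hcr hv hm
    have := Shifted.iterate M (hsim side) (t side) _ _ (hc side) hm (hcr side)
    refine ⟨t side, ?_⟩
    rw [← hv side]
    have hs := this.1
    simp only [Cfg.forget, Cfg.mk.injEq] at hs
    rw [hs.1]
  | cons x l ih =>
    intro side c t m hl hc hcr hv hm
    -- The runs on `W false` and on `W true` both reach a crossing with configuration `x`, though
    -- possibly at different times; each is compared to itself here.
    have key : ∀ s, ∃ r t', t s = r + t' ∧ ((M.step (W s))^[r] (c s)).forget = x ∧
        ((M.step (W s))^[r] (c s)).inPos = lo s + (if side then 0 else g + 1) ∧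
        M.crossings (W s) (lo s) g (!side) t' ((M.step (W s))^[r] (c s)) = l := by
      intro s
      have hself : ∀ d d', ¬ Exits (lo s) g side d.inPos → M.Shifted (lo s) (lo s) d d' →
          M.Shifted (lo s) (lo s) (M.step (W s) d) (M.step (W s) d') := by
        rintro ⟨q, p, wk, ps⟩ ⟨q', p', wk', ps'⟩ _ ⟨h1, h2⟩
        simp only [Cfg.forget, Cfg.mk.injEq, true_and] at h1
        obtain ⟨rfl, rfl, rfl⟩ := h1
        obtain rfl : p = p' := by simpa using h2
        exact ⟨rfl, rfl⟩
      obtain ⟨r, t', h1, -, h2, h3, h4⟩ := Shifted.exists_crossing M hself (t s) (c s) (c s)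
        (hl s) (hc s) ⟨rfl, rfl⟩ (hcr s)
      exact ⟨r, t', h1, h2, h3, h4⟩
    obtain ⟨r₀, t₀, -, hm₀, hx₀, hp₀, -⟩ := Shifted.exists_crossing M (hsim side) (t side)
      (c side) m (hl side) (hc side) hm (hcr side)
    choose r t' h1 h2 h3 h4 using key
    obtain ⟨k, hk⟩ := ih (!side) (fun s => (M.step (W s))^[r s] (c s)) t' ((M.step w)^[r₀] m)
      (by intro s; have := hw s; simp only [h3 s]; split_ifs <;> omega)
      (by intro s; simp only [h3 s]; cases side <;> simp [Exits])
      h4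
      (by
        intro s
        rw [← Function.iterate_add_apply, add_comm, ← h1 s]
        exact hv s)
      ⟨by simp only [h2]; rw [← hx₀]; exact hm₀.1, by
        have := hm₀.2
        simp only [h3]
        omega⟩
    exact ⟨k + r₀, by rw [Function.iterate_add_apply]; exact hk⟩

/-! ### Runs -/

theorem run_succ (w : List A) (t : ℕ) : M.run w (t + 1) = M.step w (M.run w t) :=
  Function.iterate_succ_apply' _ _ _

theorem verdict_run_of_le {w : List A} {t t' : ℕ} {b : Bool} (h : t ≤ t')
    (hv : M.verdict (M.run w t).state = some b) : M.run w t' = M.run w t := by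
  induction t', h using Nat.le_induction with
  | base => rfl
  | succ s _ ih => rw [run_succ, ih, M.step_of_verdict hv]

theorem verdict_unique {w : List A} {t t' : ℕ} {b b' : Bool}
    (hv : M.verdict (M.run w t).state = some b) (hv' : M.verdict (M.run w t').state = some b') :
    b = b' := by
  rcases le_total t t' with h | h
  · rw [M.verdict_run_of_le h hv, hv] at hv'; exact Option.some.inj hv'
  · rw [M.verdict_run_of_le h hv', hv'] at hv; exact (Option.some.inj hv).symm

/-- Equal crossing sequences of two inputs with a common middle part `g` and the same answer give
this answer for the prefix of the first followed by the suffix of the second. -/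
theorem exists_verdict_run_paste (a a' g b b' : List A) (t : ℕ) (ans : Bool)
    (hv : M.verdict (M.run (a ++ (g ++ b)) t).state = some ans)
    (hv' : M.verdict (M.run (a' ++ (g ++ b')) t).state = some ans)
    (h : M.crossings (a ++ (g ++ b)) a.length g.length false t M.initial =
      M.crossings (a' ++ (g ++ b')) a'.length g.length false t M.initial) :
    ∃ r, M.verdict (M.run (a ++ (g ++ b')) r).state = some ans := by
  refine M.exists_verdict_of_crossings_eq
    (fun s => if s then a' ++ (g ++ b') else a ++ (g ++ b)) (a ++ (g ++ b'))
    (fun s => if s then a'.length else a.length) a.length g.length ?_ ?_ ans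
    (M.crossings (a' ++ (g ++ b')) a'.length g.length false t M.initial) false
    (fun _ => M.initial) (fun _ => t) M.initial ?_ ?_ ?_ ?_ ?_
  · intro s; cases s <;> simp
  · intro s c c' hc hs
    cases s
    · exact Shifted.step_left M a g b b' hc hs
    · exact Shifted.step_right M a' a g b' hc hs
  · intro s; simp [initial]
  · intro s; simp [Exits, initial]
  · intro s; cases s
    · exact h
    · rfl
  · intro s; cases s
    · exact hv
    · exact hv'
  · exact ⟨rfl, rfl⟩

theorem length_crossings_initial_mul_le (a g b : List A) (t : ℕ) :
    (M.crossings (a ++ (g ++ b)) a.length g.length false t M.initial).length * g.length ≤ t := by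
  simpa [initial] using M.length_crossings_mul_le (a ++ (g ++ b)) a.length g.length
    t false M.initial (by simp [initial]) (by simp [Exits, initial])

/-! ### Counting configurations in bounded space -/

theorem pos_step (w : List A) (c : M.Cfg) (i : Fin (M.k + 1)) :
    (M.step w c).pos i ≤ c.pos i + 1 ∧ c.pos i ≤ (M.step w c).pos i + 1 := by
  unfold step
  split
  · omega
  · simp only
    cases (M.δ c.state (inCell w c.inPos) fun i => c.work i (c.pos i)).workMove i <;>
      simp only [moveWork] <;> omega

/-- A work head starts at `0` and moves by single cells, so it visits all cells on its way. -/
theorem mem_range_pos (w : List A) (i : Fin (M.k + 1)) (t : ℕ) :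
    ∀ z ∈ Set.uIcc 0 ((M.run w t).pos i), z ∈ Set.range fun s => (M.run w s).pos i := by
  induction t with
  | zero =>
    intro z hz
    refine ⟨0, ?_⟩
    simp [run, initial] at hz ⊢
    exact hz.symm
  | succ t ih =>
    intro z hz
    by_cases h : z = (M.run w (t + 1)).pos i
    · exact ⟨t + 1, h.symm⟩
    · have := M.pos_step w (M.run w t) i
      rw [← run_succ] at this
      refine ih z ?_
      rw [Set.mem_uIcc] at hz ⊢
      omega

theorem encard_range_pos_le {w : List A} {S : ℕ} (hS : M.spaceUsed w ≤ S) (i : Fin (M.k + 1)) :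
    (Set.range fun t => (M.run w t).pos i).encard ≤ S :=
  (Finset.single_le_sum (f := fun i => (Set.range fun t => (M.run w t).pos i).encard)
    (fun _ _ => zero_le) (Finset.mem_univ i)).trans hS

theorem one_le_of_spaceUsed_le {w : List A} {S : ℕ} (hS : M.spaceUsed w ≤ S) : 1 ≤ S := by
  have h := M.encard_range_pos_le hS 0
  have h1 : 1 ≤ (Set.range fun t => (M.run w t).pos 0).encard :=
    Set.one_le_encard_iff_nonempty.2 (Set.range_nonempty _)
  exact_mod_cast h1.trans h

theorem pos_mem_Icc {w : List A} {S : ℕ} (hS : M.spaceUsed w ≤ S) (t : ℕ) (i : Fin (M.k + 1)) :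
    (M.run w t).pos i ∈ Finset.Icc (-S : ℤ) S := by
  have h := (Set.encard_le_encard (M.mem_range_pos w i t)).trans (M.encard_range_pos_le hS i)
  rw [← Finset.coe_uIcc, Set.encard_coe_eq_coe_finsetCard] at h
  have h' : (Finset.uIcc 0 ((M.run w t).pos i)).card ≤ S := by exact_mod_cast h
  rw [Int.card_uIcc] at h'
  rw [Finset.mem_Icc]
  omega

theorem work_eq_blank {w : List A} {S : ℕ} (hS : M.spaceUsed w ≤ S) (t : ℕ) (i : Fin (M.k + 1))
    (z : ℤ) (hz : z ∉ Finset.Icc (-S : ℤ) S) : (M.run w t).work i z = M.blank := by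
  induction t with
  | zero => rfl
  | succ t ih =>
    have hne : z ≠ (M.run w t).pos i := fun h => hz (h ▸ M.pos_mem_Icc hS t i)
    rw [run_succ]
    unfold step
    split
    · exact ih
    · simp only
      rw [Function.update_of_ne hne, ih]

/-- The part of a configuration that matters in space `S`: state, work tape cells at most `S`
away from the start, and work head positions (clamped to these cells). -/
noncomputable def bounded (S : ℕ) (c : M.Cfg) :
    M.Q × (Fin (M.k + 1) → Finset.Icc (-S : ℤ) S → M.Γ) ×
      (Fin (M.k + 1) → Finset.Icc (-S : ℤ) S) :=
  (c.state, fun i z => c.work i z,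
    fun i => ⟨max (-S) (min S (c.pos i)), by rw [Finset.mem_Icc]; omega⟩)

theorem forget_eq_of_bounded_eq {w w' : List A} {S : ℕ} (hS : M.spaceUsed w ≤ S)
    (hS' : M.spaceUsed w' ≤ S) {t t' : ℕ}
    (h : M.bounded S (M.run w t).forget = M.bounded S (M.run w' t').forget) :
    (M.run w t).forget = (M.run w' t').forget := by
  simp only [bounded, Cfg.forget, Prod.mk.injEq] at h
  obtain ⟨h1, h2, h3⟩ := h
  simp only [Cfg.forget, Cfg.mk.injEq, true_and]
  refine ⟨h1, ?_, ?_⟩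
  · funext i z
    by_cases hz : z ∈ Finset.Icc (-S : ℤ) S
    · exact congrFun (congrFun h2 i) ⟨z, hz⟩
    · rw [M.work_eq_blank hS t i z hz, M.work_eq_blank hS' t' i z hz]
  · funext i
    have := congrFun h3 i
    have hp := Finset.mem_Icc.1 (M.pos_mem_Icc hS t i)
    have hp' := Finset.mem_Icc.1 (M.pos_mem_Icc hS' t' i)
    have := congrArg Subtype.val this
    simp only at this
    omega

/-- The constant in the bound `2 ^ (M.configExponent * S)` for the number of configurations in
space `S ≥ 1`. -/
noncomputable def configExponent : ℕ :=
  Nat.card M.Q + (M.k + 1) * (3 * Nat.card M.Γ) + (M.k + 1) * 3 + 1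

theorem card_bounded_add_one_le (S : ℕ) (hS : 1 ≤ S) :
    Nat.card (M.Q × (Fin (M.k + 1) → Finset.Icc (-S : ℤ) S → M.Γ) ×
      (Fin (M.k + 1) → Finset.Icc (-S : ℤ) S)) + 1 ≤ 2 ^ (M.configExponent * S) := by
  have := M.finQ
  have := M.finΓ
  have hI : Nat.card (Finset.Icc (-S : ℤ) S) = 2 * S + 1 := by
    rw [Nat.card_eq_fintype_card, Fintype.card_coe, Int.card_Icc]; omega
  rw [Nat.card_prod, Nat.card_prod, Nat.card_fun, Nat.card_fun, Nat.card_fun, hI, Nat.card_fin]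
  set q := Nat.card M.Q with hq
  set γ := Nat.card M.Γ with hγ
  set k := M.k + 1
  have e1 : q ≤ 2 ^ q := Nat.lt_two_pow_self.le
  have e2 : (γ ^ (2 * S + 1)) ^ k ≤ 2 ^ (k * ((2 * S + 1) * γ)) := by
    calc (γ ^ (2 * S + 1)) ^ k ≤ (((2 ^ γ) ^ (2 * S + 1))) ^ k := by
          gcongr; exact Nat.lt_two_pow_self.le
      _ = _ := by rw [← pow_mul, ← pow_mul]; congr 1; ring
  have e3 : (2 * S + 1) ^ k ≤ 2 ^ (k * (2 * S + 1)) := by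
    rw [mul_comm k, pow_mul]
    gcongr
    exact Nat.lt_two_pow_self.le
  calc q * ((γ ^ (2 * S + 1)) ^ k * (2 * S + 1) ^ k) + 1
      ≤ 2 ^ q * (2 ^ (k * ((2 * S + 1) * γ)) * 2 ^ (k * (2 * S + 1))) + 1 := by gcongr
    _ = 2 ^ (q + (k * ((2 * S + 1) * γ) + k * (2 * S + 1))) + 1 := by simp only [pow_add]
    _ ≤ 2 ^ (q + (k * ((2 * S + 1) * γ) + k * (2 * S + 1)) + 1) := by
        rw [pow_succ]; have := Nat.one_le_two_pow (n := q + (k * ((2 * S + 1) * γ) + k * (2 * S + 1)))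
        omega
    _ ≤ 2 ^ (M.configExponent * S) := by
        apply Nat.pow_le_pow_right two_pos
        have f1 : q ≤ q * S := Nat.le_mul_of_pos_right _ hS
        have f2 : k * ((2 * S + 1) * γ) ≤ k * ((3 * S) * γ) := by gcongr; omega
        have f3 : k * (2 * S + 1) ≤ k * (3 * S) := by gcongr; omega
        calc _ ≤ q * S + (k * ((3 * S) * γ) + k * (3 * S)) + S := by omega
          _ = M.configExponent * S := by rw [configExponent]; ring

/-- Pairwise different crossing sequences of length at most `R`, arising in space `S`, form a
family of at most `2 ^ (M.configExponent * S * R)` members. -/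
theorem card_le_of_crossings_injective {ι : Type} [Finite ι] (w : ι → List A) (lo : ι → ℕ)
    (g t S R : ℕ) (hS1 : 1 ≤ S) (hS : ∀ i, M.spaceUsed (w i) ≤ S)
    (hR : ∀ i, (M.crossings (w i) (lo i) g false t M.initial).length ≤ R)
    (hinj : Function.Injective fun i => M.crossings (w i) (lo i) g false t M.initial) :
    Nat.card ι ≤ 2 ^ (M.configExponent * S * R) := by
  have := M.finQ
  have := M.finΓ
  let F : ι → Fin R → Option (M.Q × (Fin (M.k + 1) → Finset.Icc (-S : ℤ) S → M.Γ) ×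
      (Fin (M.k + 1) → Finset.Icc (-S : ℤ) S)) := fun i j =>
    (M.crossings (w i) (lo i) g false t M.initial)[(j : ℕ)]?.map (M.bounded S)
  have hF : Function.Injective F := by
    intro i i' h
    apply hinj
    apply List.ext_getElem?
    intro j
    rcases lt_or_ge j R with hj | hj
    · have := congrFun h ⟨j, hj⟩
      simp only [F] at this
      cases h1 : (M.crossings (w i) (lo i) g false t M.initial)[j]? with
      | none => rw [h1] at this; simpa [eq_comm] using this
      | some x =>
        cases h2 : (M.crossings (w i') (lo i') g false t M.initial)[j]? with
        | none => rw [h1, h2] at this; simp at this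
        | some y =>
          rw [h1, h2] at this
          obtain ⟨s, rfl⟩ := M.exists_of_mem_crossings _ _ _ _ _ _ _ (List.mem_of_getElem? h1)
          obtain ⟨s', rfl⟩ := M.exists_of_mem_crossings _ _ _ _ _ _ _ (List.mem_of_getElem? h2)
          congr 1
          exact M.forget_eq_of_bounded_eq (hS i) (hS i') (Option.some.inj this)
    · rw [List.getElem?_eq_none ((hR i).trans hj), List.getElem?_eq_none ((hR i').trans hj)]
  refine (Nat.card_le_card_of_injective F hF).trans ?_
  rw [Nat.card_fun, Finite.card_option, Nat.card_fin, pow_mul]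
  exact Nat.pow_le_pow_left (M.card_bounded_add_one_le S hS1) R

end Machine

/-! ### Traces without proper synchronization -/

/-- Every lock is acquired at most once and never released. -/
def LocksOnce (σ : List Event) : Prop :=
  ∀ l : ℕ, ∃ t : ℕ, (σ.filter fun e => e.op.OnLock l).Sublist [⟨t, .acq l⟩]

theorem LocksOnce.of_sublist {σ σ' : List Event} (h : LocksOnce σ) (hs : σ'.Sublist σ) :
    LocksOnce σ' := fun l =>
  let ⟨t, ht⟩ := h l
  ⟨t, (hs.filter _).trans ht⟩

theorem LocksOnce.isTrace {σ : List Event} (h : LocksOnce σ) : IsTrace σ := by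
  intro l
  obtain ⟨t, ht⟩ := h l
  refine ⟨[t], ?_⟩
  rcases List.sublist_singleton.1 ht with h | h <;> rw [h] <;> simp

theorem traceOrder_finRange (σ : List Event) (e₁ e₂ : Fin σ.length) :
    TraceOrder σ (List.finRange σ.length) e₁ e₂ ↔ e₁ ≤ e₂ := by
  simp [TraceOrder]

theorem idxOf_le_idxOf_iff_of_sublist_finRange {n : ℕ} {ρ : List (Fin n)}
    (h : ρ.Sublist (List.finRange n)) {a b : Fin n} (ha : a ∈ ρ) (hb : b ∈ ρ) :
    ρ.idxOf a ≤ ρ.idxOf b ↔ a ≤ b := by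
  have hs : ρ.Pairwise (· < ·) := (List.pairwise_lt_finRange n).sublist h
  have hm : StrictMono ρ.get := hs.sortedLT.strictMono_get
  have := hm.le_iff_le (a := ⟨ρ.idxOf a, List.idxOf_lt_length_iff.2 ha⟩)
    (b := ⟨ρ.idxOf b, List.idxOf_lt_length_iff.2 hb⟩)
  simpa using this.symm

/-- If every lock is acquired at most once and never released, and no variable is both read and
written, then nothing orders events of different threads, and every conflict is a race. The
reordering consists of the predecessors of the two events in their threads. -/
theorem isSyncPreservingRace_of_conflicting {σ : List Event} (hσ : LocksOnce σ)
    (hrw : ∀ x, ∀ e ∈ σ, ∀ e' ∈ σ, e.op = .read x → e'.op ≠ .write x)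
    {e₁ e₂ : Fin σ.length} (h : Conflicting σ e₁ e₂) : IsSyncPreservingRace σ e₁ e₂ := by
  set ρ : List (Fin σ.length) := (List.finRange σ.length).filter fun e =>
    (threadOf σ e = threadOf σ e₁ ∧ e < e₁) ∨ (threadOf σ e = threadOf σ e₂ ∧ e < e₂) with hρ
  have hsub : ρ.Sublist (List.finRange σ.length) := List.filter_sublist
  have hmem : ∀ e, e ∈ ρ ↔ (threadOf σ e = threadOf σ e₁ ∧ e < e₁) ∨
      (threadOf σ e = threadOf σ e₂ ∧ e < e₂) := by intro e; simp [hρ]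
  have hnone : ∀ (ρ' : List (Fin σ.length)) e x, opOf σ e = .read x →
      lastWrite σ ρ' x e = none := by
    intro ρ' e x hx
    rw [lastWrite, List.getLast?_eq_none_iff, List.filter_eq_nil_iff]
    intro e' _ he'
    have := (of_decide_eq_true he').1
    exact hrw x _ (List.get_mem σ e) _ (List.get_mem σ e') hx this
  refine ⟨h, ρ, ⟨?_, ?_, ?_, ?_, ?_⟩, ?_, ⟨?_, ?_⟩, ⟨?_, ?_⟩⟩
  · exact (List.nodup_finRange _).sublist hsub
  · refine (hσ.of_sublist ?_).isTrace
    have := hsub.map σ.get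
    rwa [List.map_get_finRange] at this
  · rintro e e' ⟨h1, h2⟩ h3
    rw [traceOrder_finRange] at h1
    rw [hmem] at h3 ⊢
    rw [h2]
    exact h3.imp (fun h => ⟨h.1, h1.trans_lt h.2⟩) fun h => ⟨h.1, h1.trans_lt h.2⟩
  · rintro e e' ⟨⟨h1, h2, h3⟩, h4⟩
    exact ⟨(traceOrder_finRange σ e e').2
      ((idxOf_le_idxOf_iff_of_sublist_finRange hsub h1 h2).1 h3), h4⟩
  · intro e _ x hx
    rw [hnone _ _ _ hx, hnone _ _ _ hx]
  · intro l e he e' he' _ _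
    rw [traceOrder_finRange, ← idxOf_le_idxOf_iff_of_sublist_finRange hsub he he']
    exact ⟨fun h => h.2.2, fun h => ⟨he, he', h⟩⟩
  · rw [hmem]
    rintro (h' | h')
    · exact lt_irrefl _ h'.2
    · exact h.1 h'.1
  · rintro e' hne ⟨h1, h2⟩
    rw [traceOrder_finRange] at h1
    exact (hmem _).2 (Or.inl ⟨h2, lt_of_le_of_ne h1 hne⟩)
  · rw [hmem]
    rintro (h' | h')
    · exact h.1 h'.1.symm
    · exact lt_irrefl _ h'.2
  · rintro e' hne ⟨h1, h2⟩
    rw [traceOrder_finRange] at h1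
    exact (hmem _).2 (Or.inr ⟨h2, lt_of_le_of_ne h1 hne⟩)

/-! ### Traces that encode set disjointness -/

/-- Thread `t` writes the variables `i + 1` with `i ∈ X`; for `i ∉ X` it reads the variable `0`,
which is never written. -/
def setEvents (t : ℕ) {n : ℕ} (X : Finset (Fin n)) : List Event :=
  (List.finRange n).map fun i => ⟨t, if i ∈ X then .write (i + 1) else .read 0⟩

/-- `G` events, none of them a write, in which all threads below `τ` and all locks below `L` occur
if `τ, L ≤ G`. -/
def gapEvents (τ L G : ℕ) : List Event :=
  (List.range G).map fun i => ⟨if i < τ then i else 0, if i < L then .acq i else .read 0⟩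

/-- The trace for the question whether `X` and `Y` are disjoint. -/
def disjTrace (τ L G : ℕ) {n : ℕ} (X Y : Finset (Fin n)) : List Event :=
  setEvents 0 X ++ (gapEvents τ L G ++ setEvents 1 Y)

theorem mem_setEvents {t n : ℕ} {X : Finset (Fin n)} {e : Event} :
    e ∈ setEvents t X ↔ ∃ i : Fin n, ⟨t, if i ∈ X then .write (i + 1) else .read 0⟩ = e := by
  simp [setEvents]

theorem mem_gapEvents {τ L G : ℕ} {e : Event} :
    e ∈ gapEvents τ L G ↔ ∃ i < G,
      ⟨if i < τ then i else 0, if i < L then .acq i else .read 0⟩ = e := by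
  simp [gapEvents]

theorem filter_onLock_setEvents (t l : ℕ) {n : ℕ} (X : Finset (Fin n)) :
    (setEvents t X).filter (fun e => e.op.OnLock l) = [] := by
  rw [List.filter_eq_nil_iff]
  intro e he
  obtain ⟨i, rfl⟩ := mem_setEvents.1 he
  simp only [Op.OnLock]
  split_ifs <;> simp

theorem locksOnce_disjTrace (τ L G : ℕ) {n : ℕ} (X Y : Finset (Fin n)) :
    LocksOnce (disjTrace τ L G X Y) := by
  intro l
  refine ⟨if l < τ then l else 0, ?_⟩
  rw [disjTrace, List.filter_append, List.filter_append, filter_onLock_setEvents,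
    filter_onLock_setEvents, List.nil_append, List.append_nil, gapEvents, List.filter_map]
  have hp : ∀ i, ((fun e : Event => decide (e.op.OnLock l)) ∘ fun i : ℕ =>
      (⟨if i < τ then i else 0, if i < L then .acq i else .read 0⟩ : Event)) i =
      decide (i < L ∧ i = l) := by
    intro i
    by_cases hi : i < L <;> simp [Op.OnLock, hi]
  rw [List.filter_congr fun i _ => hp i]
  by_cases hl : l < L
  · have h1 : ((List.range G).filter fun i => decide (i < L ∧ i = l)).Sublist [l] := by
      have : ((List.range G).filter fun i => decide (i < L ∧ i = l)) =
          (List.range G).filter (· == l) :=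
        List.filter_congr fun i _ => by
          rw [Bool.eq_iff_iff]; simp; rintro rfl; exact hl
      rw [this, List.filter_beq]
      exact List.replicate_sublist_replicate (n := 1) l |>.2
        (List.nodup_iff_count_le_one.1 List.nodup_range l)
    have := h1.map fun i : ℕ =>
      (⟨if i < τ then i else 0, if i < L then .acq i else .read 0⟩ : Event)
    simpa [hl] using this
  · rw [List.filter_eq_nil_iff.2]
    · simp
    · rintro i - h
      have := of_decide_eq_true h
      omega

theorem mem_disjTrace {τ L G n : ℕ} {X Y : Finset (Fin n)} {e : Event} :
    e ∈ disjTrace τ L G X Y ↔ e ∈ setEvents 0 X ∨ e ∈ gapEvents τ L G ∨ e ∈ setEvents 1 Y := by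
  simp [disjTrace]

theorem write_mem_disjTrace {τ L G n : ℕ} {X Y : Finset (Fin n)} {e : Event} {x : ℕ}
    (he : e ∈ disjTrace τ L G X Y) (hx : e.op = .write x) :
    ∃ i : Fin n, x = i + 1 ∧ (e.thread = 0 ∧ i ∈ X ∨ e.thread = 1 ∧ i ∈ Y) := by
  rcases mem_disjTrace.1 he with h | h | h
  · obtain ⟨i, rfl⟩ := mem_setEvents.1 h
    by_cases hi : i ∈ X <;> simp [hi] at hx
    exact ⟨i, hx.symm, Or.inl ⟨rfl, hi⟩⟩
  · obtain ⟨i, -, rfl⟩ := mem_gapEvents.1 h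
    by_cases hi : i < L <;> simp [hi] at hx
  · obtain ⟨i, rfl⟩ := mem_setEvents.1 h
    by_cases hi : i ∈ Y <;> simp [hi] at hx
    exact ⟨i, hx.symm, Or.inr ⟨rfl, hi⟩⟩

theorem read_mem_disjTrace {τ L G n : ℕ} {X Y : Finset (Fin n)} {e : Event} {x : ℕ}
    (he : e ∈ disjTrace τ L G X Y) (hx : e.op = .read x) : x = 0 := by
  rcases mem_disjTrace.1 he with h | h | h
  · obtain ⟨i, rfl⟩ := mem_setEvents.1 h
    by_cases hi : i ∈ X <;> simp [hi] at hx
    exact hx.symm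
  · obtain ⟨i, -, rfl⟩ := mem_gapEvents.1 h
    by_cases hi : i < L <;> simp [hi] at hx
    exact hx.symm
  · obtain ⟨i, rfl⟩ := mem_setEvents.1 h
    by_cases hi : i ∈ Y <;> simp [hi] at hx
    exact hx.symm

theorem hasSyncPreservingRace_disjTrace (τ L G : ℕ) {n : ℕ} (X Y : Finset (Fin n)) :
    HasSyncPreservingRace (disjTrace τ L G X Y) ↔ ¬ Disjoint X Y := by
  rw [Finset.not_disjoint_iff]
  constructor
  · rintro ⟨e₁, e₂, ⟨hne, x, h1, h2, h3⟩, -⟩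
    have hm₁ := List.get_mem (disjTrace τ L G X Y) e₁
    have hm₂ := List.get_mem (disjTrace τ L G X Y) e₂
    -- A written variable is not `0`, and all others are never read, so both events are writes.
    have hx : x ≠ 0 := by
      rcases h3 with h | h
      · obtain ⟨i, hi, -⟩ := write_mem_disjTrace hm₁ h; omega
      · obtain ⟨i, hi, -⟩ := write_mem_disjTrace hm₂ h; omega
    obtain ⟨i, hi, h1⟩ := write_mem_disjTrace hm₁
      (h1.resolve_left fun h => hx (read_mem_disjTrace hm₁ h))
    obtain ⟨j, hj, h2⟩ := write_mem_disjTrace hm₂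
      (h2.resolve_left fun h => hx (read_mem_disjTrace hm₂ h))
    obtain rfl : i = j := Fin.ext (by omega)
    refine ⟨i, ?_⟩
    unfold threadOf at hne
    rcases h1 with h1 | h1 <;> rcases h2 with h2 | h2
    · exact absurd (h1.1.trans h2.1.symm) hne
    · exact ⟨h1.2, h2.2⟩
    · exact ⟨h2.2, h1.2⟩
    · exact absurd (h1.1.trans h2.1.symm) hne
  · rintro ⟨i, hX, hY⟩
    obtain ⟨e₁, he₁⟩ := List.mem_iff_get.1 (mem_disjTrace (τ := τ) (L := L) (G := G) (Y := Y).2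
      (Or.inl (mem_setEvents.2 ⟨i, by rw [if_pos hX]⟩)))
    obtain ⟨e₂, he₂⟩ := List.mem_iff_get.1 (mem_disjTrace (τ := τ) (L := L) (G := G) (X := X).2
      (Or.inr (Or.inr (mem_setEvents.2 ⟨i, by rw [if_pos hY]⟩))))
    refine ⟨e₁, e₂, isSyncPreservingRace_of_conflicting (locksOnce_disjTrace τ L G X Y) ?_
      ⟨?_, i + 1, ?_⟩⟩
    · intro x e he e' he' hr hw
      have := read_mem_disjTrace he hr
      obtain ⟨j, hj, -⟩ := write_mem_disjTrace he' hw
      omega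
    · rw [threadOf, threadOf, he₁, he₂]
      exact zero_ne_one
    · rw [opOf, opOf, he₁, he₂]
      exact ⟨Or.inr rfl, Or.inr rfl, Or.inl rfl⟩

theorem disjTrace_mem_traceClass {τ L G N n : ℕ} (hN : 2 * n + G = N) (hτ : 2 ≤ τ) (hτG : τ ≤ G)
    (hLG : L ≤ G) (X Y : Finset (Fin n)) : disjTrace τ L G X Y ∈ traceClass N τ L := by
  refine ⟨(locksOnce_disjTrace τ L G X Y).isTrace, ?_, ?_, ?_, ?_⟩
  · simp [disjTrace, setEvents, gapEvents]; omega
  · ext t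
    simp only [threads, List.mem_toFinset, List.mem_map, Finset.mem_range]
    constructor
    · rintro ⟨e, he, rfl⟩
      rcases mem_disjTrace.1 he with h | h | h
      · obtain ⟨i, rfl⟩ := mem_setEvents.1 h; simp only; omega
      · obtain ⟨i, -, rfl⟩ := mem_gapEvents.1 h; simp only; split_ifs <;> omega
      · obtain ⟨i, rfl⟩ := mem_setEvents.1 h; simp only; omega
    · intro ht
      exact ⟨_, mem_disjTrace.2 (Or.inr (Or.inl (mem_gapEvents.2 ⟨t, by omega, rfl⟩))),
        by simp [ht]⟩
  · ext l
    simp only [locks, List.mem_toFinset, List.mem_filterMap, Finset.mem_range]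
    constructor
    · rintro ⟨e, he, hl⟩
      rcases mem_disjTrace.1 he with h | h | h
      · obtain ⟨i, rfl⟩ := mem_setEvents.1 h
        by_cases hi : i ∈ X <;> simp [hi, Op.lock?] at hl
      · obtain ⟨i, -, rfl⟩ := mem_gapEvents.1 h
        by_cases hi : i < L <;> simp [hi, Op.lock?] at hl
        omega
      · obtain ⟨i, rfl⟩ := mem_setEvents.1 h
        by_cases hi : i ∈ Y <;> simp [hi, Op.lock?] at hl
    · intro hl
      exact ⟨_, mem_disjTrace.2 (Or.inr (Or.inl (mem_gapEvents.2 ⟨l, by omega, rfl⟩))),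
        by simp [hl, Op.lock?]⟩
  · intro x
    simp only [vars, List.mem_toFinset, List.mem_filterMap, Finset.mem_range]
    rintro ⟨e, he, hx⟩
    rcases ho : e.op with y | y | y | y <;> rw [ho] at hx <;> simp [Op.var?] at hx <;> subst hx
    · have := read_mem_disjTrace he ho
      omega
    · obtain ⟨i, hi, -⟩ := write_mem_disjTrace he ho
      omega

/-! ### The lower bound -/

theorem length_le_length_flatMap {α β : Type} {f : α → List β} (hf : ∀ a, f a ≠ [])
    (l : List α) : l.length ≤ (l.flatMap f).length := by
  induction l with
  | nil => simp
  | cons a l ih =>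
    have := List.length_pos_iff.2 (hf a)
    simp only [List.flatMap_cons, List.length_append, List.length_cons]
    omega

/-- The traces for the pairs `(X, Xᶜ)` have no race, but exchanging their second parts creates one.
Hence they have different crossing sequences over the `G` events in the middle. There are `2 ^ n`
of them, so some crossing sequence has length of order `n / S`, which takes time of order
`G * n / S`. -/
theorem mul_le_time_mul_space {A : Type} {code : ℕ → Event → List A}
    (hcode : ∀ N e, code N e ≠ []) {τ L : ℕ → ℕ} {M : Machine A} (hM : Solves code τ L M)
    {T S : ℕ → ℕ} (hT : RunsInTime code τ L M T) (hS : RunsInSpace code τ L M S)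
    {N n G : ℕ} (hN : 2 * n + G = N) (hτ : 2 ≤ τ N) (hτG : τ N ≤ G) (hLG : L N ≤ G) :
    n * G ≤ M.configExponent * (T N * S N) := by
  have hmem : ∀ X Y : Finset (Fin n), disjTrace (τ N) (L N) G X Y ∈ traceClass N (τ N) (L N) :=
    disjTrace_mem_traceClass hN hτ hτG hLG
  set a : Finset (Fin n) → List A := fun X => (setEvents 0 X).flatMap (code N)
  set g : List A := (gapEvents (τ N) (L N) G).flatMap (code N)
  set b : Finset (Fin n) → List A := fun Y => (setEvents 1 Y).flatMap (code N)
  have henc : ∀ X Y : Finset (Fin n),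
      encode code (disjTrace (τ N) (L N) G X Y) = a X ++ (g ++ b Y) := by
    intro X Y
    rw [encode, (hmem X Y).2.1, disjTrace, List.flatMap_append, List.flatMap_append]
  have hg : G ≤ g.length := by
    have := length_le_length_flatMap (hcode N) (gapEvents (τ N) (L N) G)
    rwa [show (gapEvents (τ N) (L N) G).length = G by simp [gapEvents]] at this
  have hspace : ∀ X : Finset (Fin n), M.spaceUsed (a X ++ (g ++ b Xᶜ)) ≤ S N := by
    intro X
    rw [← henc]
    exact hS N _ (hmem X Xᶜ)
  have hverdict : ∀ X : Finset (Fin n),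
      M.verdict (M.run (a X ++ (g ++ b Xᶜ)) (T N)).state = some false := by
    intro X
    obtain ⟨c, ⟨t₀, t, -, ht⟩, hc⟩ := hM N _ (hmem X Xᶜ)
    obtain ⟨c', t', htT, ht'⟩ := hT N _ (hmem X Xᶜ)
    rw [henc] at ht ht'
    have hcf : c = false := by
      rw [← Bool.not_eq_true, hc, hasSyncPreservingRace_disjTrace, not_not]
      exact disjoint_compl_right
    rw [M.verdict_run_of_le htT ht', ht', M.verdict_unique ht' ht, hcf]
  have hinj : Function.Injective fun X : Finset (Fin n) =>
      M.crossings (a X ++ (g ++ b Xᶜ)) (a X).length g.length false (T N) M.initial := by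
    have hsub : ∀ X X' : Finset (Fin n),
        M.crossings (a X ++ (g ++ b Xᶜ)) (a X).length g.length false (T N) M.initial =
          M.crossings (a X' ++ (g ++ b X'ᶜ)) (a X').length g.length false (T N) M.initial →
        X ≤ X' := by
      intro X X' h
      obtain ⟨r, hr⟩ := M.exists_verdict_run_paste _ _ _ _ _ _ _ (hverdict X) (hverdict X') h
      obtain ⟨c, ⟨t₀, t, -, ht⟩, hc⟩ := hM N _ (hmem X X'ᶜ)
      rw [henc] at ht
      rw [M.verdict_unique ht hr, hasSyncPreservingRace_disjTrace] at hc
      exact disjoint_compl_right_iff.1 (not_not.1 fun h => Bool.false_ne_true (hc.2 h))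
    exact fun X X' h => le_antisymm (hsub X X' h) (hsub X' X h.symm)
  have hG : 0 < G := by omega
  have hlen : ∀ X : Finset (Fin n),
      (M.crossings (a X ++ (g ++ b Xᶜ)) (a X).length g.length false (T N) M.initial).length ≤
        T N / G := by
    intro X
    rw [Nat.le_div_iff_mul_le hG]
    exact (Nat.mul_le_mul_left _ hg).trans (M.length_crossings_initial_mul_le _ _ _ _)
  have hcard := M.card_le_of_crossings_injective _ _ _ _ _ _ (M.one_le_of_spaceUsed_le (hspace ∅))
    hspace hlen hinj
  rw [Nat.card_eq_fintype_card, Fintype.card_finset, Fintype.card_fin,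
    Nat.pow_le_pow_iff_right one_lt_two] at hcard
  calc n * G ≤ M.configExponent * S N * (T N / G) * G := by gcongr
    _ = M.configExponent * S N * (T N / G * G) := by ring
    _ ≤ M.configExponent * S N * T N := by gcongr; exact Nat.div_mul_le_self _ _
    _ = _ := by ring

end SyncRace

theorem mainTheorem3 {A : Type} [Finite A]
    (code : ℕ → SyncRace.Event → List A) (hcode : ∀ N e, code N e ≠ [])
    (τ L : ℕ → ℕ) (hτ : ∀ᶠ N in atTop, 2 ≤ τ N)
    (hL : (fun N : ℕ => Real.log N) =O[atTop] fun N : ℕ => (L N : ℝ))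
    (ε : ℝ) (hε : 0 < ε)
    (hτN : ∀ᶠ N in atTop, (τ N : ℝ) ≤ (1 - ε) * N)
    (hLN : ∀ᶠ N in atTop, (L N : ℝ) ≤ (1 - ε) * N)
    (M : SyncRace.Machine A) (hM : SyncRace.Solves code τ L M)
    (T S : ℕ → ℕ) (hT : SyncRace.RunsInTime code τ L M T)
    (hS : SyncRace.RunsInSpace code τ L M S) :
    (fun N : ℕ => (N : ℝ) ^ 2 / Real.log N ^ 2) =O[atTop]
      fun N : ℕ => (T N : ℝ) * (S N : ℝ) := by
  refine IsBigO.of_bound ((6 / ε) ^ 2 * M.configExponent) ?_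
  have hlarge : ∀ᶠ N : ℕ in atTop, 6 / ε ≤ N :=
    tendsto_natCast_atTop_atTop.eventually_ge_atTop _
  have hlog : ∀ᶠ N : ℕ in atTop, 1 ≤ Real.log N :=
    (Real.tendsto_log_atTop.comp tendsto_natCast_atTop_atTop).eventually_ge_atTop 1
  filter_upwards [hτ, hτN, hLN, hlarge, hlog] with N h2 hτN hLN hlarge hlog
  -- A third of the `ε * N` events that threads and locks leave free for each set.
  set n : ℕ := ⌊ε * N / 3⌋₊
  have hN0 : (0 : ℝ) ≤ N := Nat.cast_nonneg N
  have hn : (n : ℝ) ≤ ε * N / 3 := Nat.floor_le (by positivity)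
  have hn' : ε * N / 3 < n + 1 := Nat.lt_floor_add_one _
  rw [div_le_iff₀ hε] at hlarge
  have h2' : (2 : ℝ) ≤ τ N := by exact_mod_cast h2
  have hL0 : (0 : ℝ) ≤ L N := Nat.cast_nonneg _
  obtain ⟨G, hG⟩ : ∃ G, 2 * n + G = N := by
    have : 2 * n ≤ N := by
      have : (2 * n : ℝ) ≤ N := by nlinarith
      exact_mod_cast this
    exact ⟨N - 2 * n, by omega⟩
  have hG' : (2 * n + G : ℝ) = N := by exact_mod_cast hG
  have hτG : τ N ≤ G := by
    have : (τ N : ℝ) ≤ G := by nlinarith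
    exact_mod_cast this
  have hLG : L N ≤ G := by
    have : (L N : ℝ) ≤ G := by nlinarith
    exact_mod_cast this
  have hmain : (n * G : ℝ) ≤ M.configExponent * (T N * S N) := by
    exact_mod_cast SyncRace.mul_le_time_mul_space hcode hM hT hS hG h2 hτG hLG
  have hn6 : ε * N / 6 ≤ n := by linarith
  have hG6 : ε * N / 6 ≤ G := by nlinarith
  rw [Real.norm_of_nonneg (by positivity), Real.norm_of_nonneg (by positivity)]
  calc (N : ℝ) ^ 2 / Real.log N ^ 2 ≤ (N : ℝ) ^ 2 :=
        div_le_self (by positivity) (one_le_pow₀ hlog)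
    _ = (6 / ε) ^ 2 * (ε * N / 6 * (ε * N / 6)) := by field_simp
    _ ≤ (6 / ε) ^ 2 * (n * G) := by gcongr
    _ ≤ (6 / ε) ^ 2 * (M.configExponent * (T N * S N)) := by gcongr
    _ = _ := by ring
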